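/- Let $G$ be a finite simple graph with maximum degree $\Delta=\Delta(G)\le 4$ that is nice, i.e. no connected component of $G$ is isomorphic to $K_2$. A $k$-edge-weighting of $G$ is a map $\omega:E(G)\to\{1,\dots,k\}$; put $\sigma_\omega(v)=\sum_{u\in N_G(v)}\omega(vu)$, and call $\omega$ neighbour sum distinguishing if $\sigma_\omega(v)\ne\sigma_\omega(w)$ whenever $vw\in E(G)$. Then $G$ admits a neighbour sum distinguishing $6$-edge-weighting such that every vertex of degree at least $2$ is incident with at least two edges of different weights. In particular, $\chi'^{\,\Delta-1}_{\sum}(G)\le 6$. Here $\chi'^{\,d}_{\sum}(G)$ denotes the smallest integer $k\ge 1$ for which $G$ admits a neighbour sum distinguishing $k$-edge-weighting in which every monochromatic set of edges induces a subgraph of maximum degree at most $d$ (and $d=\Delta-1$ is read as $0$ when $G$ has no edges). -/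

import Mathlib

namespace SimpleGraph

variable {V : Type*}

/-- A graph is nice if none of its connected components is isomorphic to `K₂`. -/
def IsNice (G : SimpleGraph V) : Prop :=
  ∀ c : G.ConnectedComponent, IsEmpty (c.toSimpleGraph ≃g completeGraph (Fin 2))

/-- A `k`-edge-weighting: a map from the edges of `G` to `{1, …, k}`. -/
abbrev EdgeWeighting (G : SimpleGraph V) (k : ℕ) : Type _ :=
  G.edgeSet → Set.Icc 1 k

namespace EdgeWeighting

variable {G : SimpleGraph V} {k : ℕ}

/-- The weight of the edge between `v` and its neighbour `u`. -/
def weight (ω : EdgeWeighting G k) {v u : V} (h : G.Adj v u) : ℕ :=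
  (ω ⟨s(v, u), h⟩ : ℕ)

/-- The induced vertex-colouring: the sum of the weights of the edges `vu`, `u ∈ N(v)`. -/
def vertexSum [Fintype V] [DecidableRel G.Adj] (ω : EdgeWeighting G k) (v : V) : ℕ :=
  ∑ u : G.neighborSet v, ω.weight u.2

/-- Adjacent vertices have different sums. -/
def NeighbourSumDistinguishing [Fintype V] [DecidableRel G.Adj] (ω : EdgeWeighting G k) : Prop :=
  ∀ v w : V, G.Adj v w → ω.vertexSum v ≠ ω.vertexSum w

/-- `v` is incident with at least two edges of different weights. -/
def HasTwoWeightsAt (ω : EdgeWeighting G k) (v : V) : Prop :=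
  ∃ e f : G.edgeSet, v ∈ (e : Sym2 V) ∧ v ∈ (f : Sym2 V) ∧ ω e ≠ ω f

/-- Every monochromatic set `S` of edges induces a subgraph of maximum degree at most `d`,
that is, at most `d` edges of `S` are incident with any given vertex. -/
def IsRelaxed (ω : EdgeWeighting G k) (d : ℕ) : Prop :=
  ∀ S : Set G.edgeSet, (∀ e ∈ S, ∀ f ∈ S, ω e = ω f) →
    ∀ v : V, {e ∈ S | v ∈ (e : Sym2 V)}.encard ≤ d

end EdgeWeighting

/-- The smallest `k ≥ 1` for which `G` admits a neighbour sum distinguishing `d`-relaxed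
`k`-edge-colouring (`⊤` if there is no such `k`). -/
noncomputable def nsdRelaxedIndex [Fintype V] (G : SimpleGraph V) [DecidableRel G.Adj]
    (d : ℕ) : ℕ∞ :=
  ⨅ k ∈ {k : ℕ | 1 ≤ k ∧ ∃ ω : EdgeWeighting G k, ω.NeighbourSumDistinguishing ∧ ω.IsRelaxed d},
    (k : ℕ∞)

end SimpleGraph

/-! Each component is weighted greedily. Let `D` be the set of completed vertices, whose incident
weights are final. The next vertex `x` is completed through an edge `xp` with `p ∉ D`. Sums at
completed neighbours forbid at most three weights. Keeping two weights at each vertex costs little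
thanks to an invariant: an outside vertex with two edges to `D` already sees two weights. It
survives because the other edges from `x` to outside vertices can be reset freely (`exists_reset`);
only `p` may forbid one more weight.

The order is by decreasing distance from a root `r` of degree at least two, holding back `r` and two
of its neighbours `z`, `q`. The edge `qr` completes `q` and `r` together. Each end forbids at most
three weights, so failure means that the forbidden values are exactly `1, …, 6`, with total `21`.
This total depends on the weight of `zr` with coefficient `-1` or `-2`, so one weight of `zr` is
bad. One more would make the sums at `q` and `r` equal, and completing `z` excludes three: five in
all, and six are available. -/

namespace SimpleGraph

variable {V : Type*}

/-- Reassign the value `t` to the edge `xp`. -/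
def setWeight [DecidableEq V] (w : V → V → ℤ) (x p : V) (t : ℤ) : V → V → ℤ :=
  fun a b => if (a = x ∧ b = p) ∨ (a = p ∧ b = x) then t else w a b

section setWeight

variable [DecidableEq V] {w : V → V → ℤ} {x p : V} {t : ℤ}

theorem setWeight_left : setWeight w x p t x p = t := by simp [setWeight]

theorem setWeight_right : setWeight w x p t p x = t := by simp [setWeight]

theorem setWeight_of_ne {a b : V} (h : a ≠ x ∨ b ≠ p) (h' : a ≠ p ∨ b ≠ x) :
    setWeight w x p t a b = w a b := by
  unfold setWeight; rw [if_neg]; tauto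

theorem setWeight_swap : setWeight w x p t = setWeight w p x t := by
  funext a b
  unfold setWeight
  congr 1; simp only [eq_iff_iff]; tauto

theorem setWeight_symm (hw : ∀ a b, w a b = w b a) (a b : V) :
    setWeight w x p t a b = setWeight w x p t b a := by
  unfold setWeight; rw [hw a b]; congr 1; simp only [eq_iff_iff]; tauto

theorem setWeight_mem_Icc (hw : ∀ a b, w a b ∈ Set.Icc (1 : ℤ) 6) (ht : t ∈ Set.Icc (1 : ℤ) 6)
    (a b : V) : setWeight w x p t a b ∈ Set.Icc (1 : ℤ) 6 := by
  unfold setWeight; split_ifs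
  · exact ht
  · exact hw a b

end setWeight

section weightSum

variable [Fintype V] (G : SimpleGraph V) [DecidableRel G.Adj]

/-- The sum at `v` of the weights of the edges at `v`. -/
def weightSum (w : V → V → ℤ) (v : V) : ℤ := ∑ u ∈ G.neighborFinset v, w v u

variable {G}

theorem weightSum_congr {w w' : V → V → ℤ} {v : V} (h : ∀ u, w v u = w' v u) :
    G.weightSum w v = G.weightSum w' v :=
  Finset.sum_congr rfl fun u _ => h u

end weightSum

/-- The edges at `x` with an end in `D` carry at least two weights. -/
def Diverse (G : SimpleGraph V) (D : Finset V) (w : V → V → ℤ) (x : V) : Prop :=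
  ∃ a ∈ D, ∃ b ∈ D, G.Adj x a ∧ G.Adj x b ∧ w x a ≠ w x b

section Diverse

variable {G : SimpleGraph V} {D : Finset V} {w : V → V → ℤ} {x : V}

theorem Diverse.mono {E : Finset V} (h : G.Diverse D w x) (hDE : D ⊆ E) : G.Diverse E w x := by
  obtain ⟨a, ha, b, hb, h⟩ := h
  exact ⟨a, hDE ha, b, hDE hb, h⟩

theorem Diverse.congr {w' : V → V → ℤ} (h : G.Diverse D w x) (hw : ∀ a ∈ D, w x a = w' x a) :
    G.Diverse D w' x := by
  obtain ⟨a, ha, b, hb, hxa, hxb, h⟩ := h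
  exact ⟨a, ha, b, hb, hxa, hxb, by rwa [← hw a ha, ← hw b hb]⟩

end Diverse

variable [Fintype V] [DecidableEq V] (G : SimpleGraph V) [DecidableRel G.Adj]

/-- A weighting by `1, …, 6` that has the required properties at the vertices of `D`, and that has
two weights on the edges from `y` to `D` for every `y ∉ D` with at least two such edges. -/
structure IsGoodOn (D : Finset V) (w : V → V → ℤ) : Prop where
  symm : ∀ a b, w a b = w b a
  mem_Icc : ∀ a b, w a b ∈ Set.Icc (1 : ℤ) 6
  sum_ne : ∀ x ∈ D, ∀ y ∈ D, G.Adj x y → G.weightSum w x ≠ G.weightSum w y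
  diverse : ∀ x ∈ D, 2 ≤ G.degree x → G.Diverse Finset.univ w x
  diverse_out : ∀ y ∉ D, ∀ a ∈ D, ∀ b ∈ D, G.Adj y a → G.Adj y b → a ≠ b → G.Diverse D w y

variable {G} {w : V → V → ℤ} {D : Finset V} {x p : V} {t : ℤ}

theorem weightSum_setWeight_of_ne {v : V} (hx : v ≠ x) (hp : v ≠ p) :
    G.weightSum (setWeight w x p t) v = G.weightSum w v :=
  weightSum_congr fun _ => setWeight_of_ne (.inl hx) (.inl hp)

theorem weightSum_setWeight_left (hxp : G.Adj x p) :
    G.weightSum (setWeight w x p t) x = G.weightSum w x - w x p + t := by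
  have hp : p ∈ G.neighborFinset x := by simpa using hxp
  unfold weightSum
  rw [← Finset.add_sum_erase _ _ hp, ← Finset.add_sum_erase _ (fun u => w x u) hp, setWeight_left,
    Finset.sum_congr rfl (g := fun u => w x u)]
  · ring
  · intro u hu
    exact setWeight_of_ne (.inr (Finset.ne_of_mem_erase hu)) (.inl hxp.ne)

theorem weightSum_setWeight_right (hxp : G.Adj x p) :
    G.weightSum (setWeight w x p t) p = G.weightSum w p - w p x + t := by
  rw [setWeight_swap, weightSum_setWeight_left hxp.symm]

/-! ### Completing one vertex -/

namespace IsGoodOn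

/-- Completing one more vertex `x` by choosing the weight of an edge `xp`. -/
theorem insert (h : G.IsGoodOn D w) (hx : x ∉ D) (hp : p ∉ D) (hxp : G.Adj x p)
    (hout : ∀ y ∉ D, y ≠ p → G.Adj y x → ∀ a ∈ D, G.Adj y a → G.Diverse (insert x D) w y)
    (ht : t ∈ Set.Icc (1 : ℤ) 6)
    (hsum : ∀ v ∈ D, G.Adj x v → G.weightSum w v ≠ G.weightSum w x - w x p + t)
    (hdiv : 2 ≤ G.degree x → G.Diverse Finset.univ (setWeight w x p t) x)
    (hpdiv : ∀ a ∈ D, G.Adj p a → G.Diverse (Insert.insert x D) (setWeight w x p t) p) :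
    G.IsGoodOn (Insert.insert x D) (setWeight w x p t) := by
  have hD : ∀ v ∈ D, G.weightSum (setWeight w x p t) v = G.weightSum w v := fun v hv =>
    weightSum_setWeight_of_ne (by rintro rfl; exact hx hv) (by rintro rfl; exact hp hv)
  have hxs : G.weightSum (setWeight w x p t) x = G.weightSum w x - w x p + t :=
    weightSum_setWeight_left hxp
  refine ⟨setWeight_symm h.symm, setWeight_mem_Icc h.mem_Icc ht, ?_, ?_, ?_⟩
  · intro a ha b hb hab
    rw [Finset.mem_insert] at ha hb
    rcases ha with rfl | ha <;> rcases hb with rfl | hb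
    · exact absurd rfl hab.ne
    · rw [hxs, hD b hb]; exact (hsum b hb hab).symm
    · rw [hxs, hD a ha]; exact hsum a ha hab.symm
    · rw [hD a ha, hD b hb]; exact h.sum_ne a ha b hb hab
  · intro a ha hdeg
    rw [Finset.mem_insert] at ha
    rcases ha with rfl | ha
    · exact hdiv hdeg
    · refine (h.diverse a ha hdeg).congr fun b _ => (setWeight_of_ne (.inl ?_) (.inl ?_)).symm
      · rintro rfl; exact hx ha
      · rintro rfl; exact hp ha
  · intro y hy a ha b hb hya hyb hab
    simp only [Finset.mem_insert, not_or] at hy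
    have key : ∀ c ∈ D, G.Adj y c → G.Adj y x →
        G.Diverse (Insert.insert x D) (setWeight w x p t) y := by
      intro c hc hyc hyx
      by_cases hyp : y = p
      · subst hyp; exact hpdiv c hc hyc
      · exact (hout y hy.2 hyp hyx c hc hyc).congr fun b _ =>
          (setWeight_of_ne (.inl hy.1) (.inl hyp)).symm
    rw [Finset.mem_insert] at ha hb
    rcases ha with rfl | ha <;> rcases hb with rfl | hb
    · exact absurd rfl hab
    · exact key b hb hyb hya
    · exact key a ha hya hyb
    · refine ((h.diverse_out y hy.2 a ha b hb hya hyb hab).congr fun c hc =>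
        (setWeight_of_ne (.inl hy.1) (.inr ?_)).symm).mono (Finset.subset_insert _ _)
      rintro rfl; exact hx hc

/-- Completing the last two vertices `q` and `r` by choosing the weight of the edge `qr`. -/
theorem insert_insert {q r : V} (h : G.IsGoodOn D w) (hq : q ∉ D) (hr : r ∉ D) (hqr : G.Adj q r)
    (hNq : ∀ y, G.Adj q y → y ∈ D ∨ y = r) (hNr : ∀ y, G.Adj r y → y ∈ D ∨ y = q)
    (hne : G.weightSum w q ≠ G.weightSum w r) (ht : t ∈ Set.Icc (1 : ℤ) 6)
    (hsumq : ∀ v ∈ D, G.Adj q v → G.weightSum w v ≠ G.weightSum w q - w q r + t)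
    (hsumr : ∀ v ∈ D, G.Adj r v → G.weightSum w v ≠ G.weightSum w r - w r q + t)
    (hdivq : 2 ≤ G.degree q → G.Diverse Finset.univ (setWeight w q r t) q)
    (hdivr : 2 ≤ G.degree r → G.Diverse Finset.univ (setWeight w q r t) r) :
    G.IsGoodOn (Insert.insert q (Insert.insert r D)) (setWeight w q r t) := by
  have hD : ∀ v ∈ D, G.weightSum (setWeight w q r t) v = G.weightSum w v := fun v hv =>
    weightSum_setWeight_of_ne (by rintro rfl; exact hq hv) (by rintro rfl; exact hr hv)
  have hqs : G.weightSum (setWeight w q r t) q = G.weightSum w q - w q r + t :=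
    weightSum_setWeight_left hqr
  have hrs : G.weightSum (setWeight w q r t) r = G.weightSum w r - w r q + t :=
    weightSum_setWeight_right hqr
  -- Both sums lose the same old weight of `qr` and gain `t`, so they still differ.
  have hw := h.symm q r
  refine ⟨setWeight_symm h.symm, setWeight_mem_Icc h.mem_Icc ht, ?_, ?_, ?_⟩
  · intro a ha b hb hab
    simp only [Finset.mem_insert] at ha hb
    rcases ha with rfl | rfl | ha <;> rcases hb with rfl | rfl | hb
    · exact absurd rfl hab.ne
    · rw [hqs, hrs]; omega
    · rw [hqs, hD b hb]; exact (hsumq b hb hab).symm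
    · rw [hqs, hrs]; omega
    · exact absurd rfl hab.ne
    · rw [hrs, hD b hb]; exact (hsumr b hb hab).symm
    · rw [hqs, hD a ha]; exact hsumq a ha hab.symm
    · rw [hrs, hD a ha]; exact hsumr a ha hab.symm
    · rw [hD a ha, hD b hb]; exact h.sum_ne a ha b hb hab
  · intro a ha hdeg
    simp only [Finset.mem_insert] at ha
    rcases ha with rfl | rfl | ha
    · exact hdivq hdeg
    · exact hdivr hdeg
    · refine (h.diverse a ha hdeg).congr fun b _ => (setWeight_of_ne (.inl ?_) (.inl ?_)).symm
      · rintro rfl; exact hq ha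
      · rintro rfl; exact hr ha
  · intro y hy a ha b hb hya hyb hab
    simp only [Finset.mem_insert, not_or] at hy
    have hmem : ∀ c ∈ Insert.insert q (Insert.insert r D), G.Adj y c → c ∈ D := by
      intro c hc hyc
      simp only [Finset.mem_insert] at hc
      rcases hc with rfl | rfl | hc
      · rcases hNq y hyc.symm with h1 | h1
        exacts [absurd h1 hy.2.2, absurd h1 hy.2.1]
      · rcases hNr y hyc.symm with h1 | h1
        exacts [absurd h1 hy.2.2, absurd h1 hy.1]
      · exact hc
    refine ((h.diverse_out y hy.2.2 a (hmem a ha hya) b (hmem b hb hyb) hya hyb hab).congr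
      fun c _ => (setWeight_of_ne (.inl hy.1) (.inl hy.2.1)).symm).mono ?_
    exact (Finset.subset_insert _ _).trans (Finset.subset_insert _ _)

/-- At most one weight of `xp` leaves `x` with a single weight, and none does if `x` has two
neighbours in `D`. -/
theorem exists_forbidden_diverse (h : G.IsGoodOn D w) (hx : x ∉ D) (hp : p ∉ D)
    (hxp : G.Adj x p) :
    ∃ M : Finset ℤ, (∀ t ∉ M, 2 ≤ G.degree x → G.Diverse Finset.univ (setWeight w x p t) x) ∧
      M.card ≤ 1 ∧ (2 ≤ (G.neighborFinset x ∩ D).card → M = ∅) := by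
  by_cases hc : 2 ≤ (G.neighborFinset x ∩ D).card
  · refine ⟨∅, fun t _ _ => ?_, by simp, fun _ => rfl⟩
    obtain ⟨a, ha, b, hb, hab⟩ := Finset.one_lt_card.1 hc
    simp only [Finset.mem_inter, mem_neighborFinset] at ha hb
    refine ((h.diverse_out x hx a ha.2 b hb.2 ha.1 hb.1 hab).congr fun c hc =>
      (setWeight_of_ne (.inr ?_) (.inl hxp.ne)).symm).mono (Finset.subset_univ _)
    rintro rfl; exact hp hc
  · by_cases hd : ∃ y, G.Adj x y ∧ y ≠ p
    · obtain ⟨y, hxy, hyp⟩ := hd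
      refine ⟨{w x y}, fun t ht _ => ?_, by simp, fun h' => absurd h' hc⟩
      refine ⟨p, Finset.mem_univ _, y, Finset.mem_univ _, hxp, hxy, ?_⟩
      rw [setWeight_left, setWeight_of_ne (.inr hyp) (.inl hxp.ne)]
      simpa using ht
    · refine ⟨∅, fun t _ h2 => ?_, by simp, fun _ => rfl⟩
      push Not at hd
      obtain ⟨a, ha, b, hb, hab⟩ := Finset.one_lt_card.1 (show 1 < (G.neighborFinset x).card from h2)
      rw [mem_neighborFinset] at ha hb
      exact absurd ((hd a ha).trans (hd b hb).symm) hab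

/-- The weights of `xp` for which the sum at `x` equals that of a neighbour in `D`. -/
def _root_.SimpleGraph.forbiddenSums (G : SimpleGraph V) [DecidableRel G.Adj] (D : Finset V)
    (w : V → V → ℤ) (x p : V) : Finset ℤ :=
  (G.neighborFinset x ∩ D).image fun v => G.weightSum w v - (G.weightSum w x - w x p)

theorem _root_.SimpleGraph.ne_of_notMem_forbiddenSums (ht : t ∉ G.forbiddenSums D w x p) :
    ∀ v ∈ D, G.Adj x v → G.weightSum w v ≠ G.weightSum w x - w x p + t := by
  intro v hv hxv he
  apply ht
  rw [forbiddenSums, Finset.mem_image]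
  exact ⟨v, by simp [hv, hxv], by rw [he]; ring⟩

theorem _root_.SimpleGraph.card_neighborFinset_inter_lt (hp : p ∉ D) (hxp : G.Adj x p) :
    (G.neighborFinset x ∩ D).card < G.degree x := by
  refine Finset.card_lt_card ⟨Finset.inter_subset_left, fun hs => hp ?_⟩
  exact (Finset.mem_inter.1 (hs (by simpa using hxp))).2

/-- The edges from `x` to the vertices outside `D` can be reweighted so that completing `x` keeps
two weights on the edges from each outside vertex. -/
theorem exists_reset (h : G.IsGoodOn D w) (hx : x ∉ D) :
    ∃ w', G.IsGoodOn D w' ∧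
      ∀ y ∉ D, G.Adj y x → ∀ a ∈ D, G.Adj y a → G.Diverse (Insert.insert x D) w' y := by
  classical
  -- `s` is a new weight for `xy` that differs from the weight of some edge from `y` to `D`.
  have hf : ∀ y, ∃ s ∈ Set.Icc (1 : ℤ) 6,
      (∃ a ∈ D, G.Adj y a) → ∃ a ∈ D, G.Adj y a ∧ w y a ≠ s := by
    intro y
    by_cases hy : ∃ a ∈ D, G.Adj y a
    · obtain ⟨a, ha, hya⟩ := hy
      by_cases h1 : w y a = 1
      · exact ⟨2, by norm_num, fun _ => ⟨a, ha, hya, by rw [h1]; norm_num⟩⟩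
      · exact ⟨1, by norm_num, fun _ => ⟨a, ha, hya, h1⟩⟩
    · exact ⟨1, by norm_num, fun h' => absurd h' hy⟩
  choose f hf6 hf using hf
  -- No edge with an end in `D` changes, so everything already achieved persists.
  let w' : V → V → ℤ := fun a b =>
    if a = x ∧ b ∉ D then f b else if b = x ∧ a ∉ D then f a else w a b
  have hD : ∀ a ∈ D, ∀ b, w' a b = w a b := by
    intro a ha b
    have : a ≠ x := by rintro rfl; exact hx ha
    simp [w', this, ha]
  have hsymm : ∀ a b, w' a b = w' b a := by
    intro a b
    by_cases ha : a = x <;> by_cases hb : b = x <;> by_cases haD : a ∈ D <;>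
      by_cases hbD : b ∈ D <;> simp_all [w', h.symm a b, h.symm x b, h.symm a x]
  have hD' : ∀ a ∈ D, ∀ b, w b a = w' b a := by
    intro a ha b
    rw [hsymm, hD a ha, h.symm]
  refine ⟨w', ⟨hsymm, ?_, ?_, ?_, ?_⟩, ?_⟩
  · intro a b
    simp only [w']; split_ifs
    exacts [hf6 b, hf6 a, h.mem_Icc a b]
  · intro a ha b hb hab
    rw [weightSum_congr (hD a ha), weightSum_congr (hD b hb)]
    exact h.sum_ne a ha b hb hab
  · intro a ha hdeg
    exact (h.diverse a ha hdeg).congr fun b _ => (hD a ha b).symm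
  · intro y hy a ha b hb hya hyb hab
    exact (h.diverse_out y hy a ha b hb hya hyb hab).congr fun c hc => hD' c hc y
  · intro y hy hyx a ha hya
    obtain ⟨b, hb, hyb, hne⟩ := hf y ⟨a, ha, hya⟩
    refine ⟨b, Finset.mem_insert_of_mem hb, x, Finset.mem_insert_self _ _, hyb, hyx, ?_⟩
    rw [← hD' b hb]
    have : w' y x = f y := by
      simp [w', hyx.ne, hy]
    rwa [this]

theorem _root_.SimpleGraph.exists_weight_notMem {F : Finset ℤ} (hF : F.card ≤ 5) :
    ∃ t ∈ Set.Icc (1 : ℤ) 6, t ∉ F := by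
  by_contra! hc
  have : Finset.Icc (1 : ℤ) 6 ⊆ F := fun t ht => hc t (by simpa using ht)
  have := Finset.card_le_card this
  simp at this
  omega

/-- Completing `x`: at most three weights of `xp` are forbidden by `x`. -/
theorem exists_insert (h : G.IsGoodOn D w) (hdeg : G.degree x ≤ 4) (hx : x ∉ D) (hp : p ∉ D)
    (hxp : G.Adj x p) :
    ∃ (w' : V → V → ℤ) (F : Finset ℤ), G.IsGoodOn D w' ∧ F.card ≤ 3 ∧ ∀ t ∈ Set.Icc (1 : ℤ) 6, t ∉ F →
      (∀ a ∈ D, G.Adj p a → G.Diverse D w' p ∨ ∃ c ∈ D, G.Adj p c ∧ w' p c ≠ t) →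
      G.IsGoodOn (Insert.insert x D) (setWeight w' x p t) := by
  obtain ⟨w', h', hw'⟩ := h.exists_reset hx
  obtain ⟨M, hM, hM1, hM2⟩ := h'.exists_forbidden_diverse hx hp hxp
  refine ⟨w', G.forbiddenSums D w' x p ∪ M, h', ?_, ?_⟩
  · have h1 : (G.forbiddenSums D w' x p).card ≤ _ := Finset.card_image_le
    have h2 := card_neighborFinset_inter_lt hp hxp
    have h3 := Finset.card_union_le (G.forbiddenSums D w' x p) M
    -- With two completed neighbours, `M` is empty and at most three sums count; otherwise at most
    -- one sum and one weight from `M` do.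
    by_cases hc : 2 ≤ (G.neighborFinset x ∩ D).card
    · rw [hM2 hc, Finset.card_empty] at h3
      rw [hM2 hc]; omega
    · omega
  · intro t ht htF hpd
    rw [Finset.mem_union, not_or] at htF
    refine h'.insert hx hp hxp (fun y hy _ => hw' y hy) ht (ne_of_notMem_forbiddenSums htF.1)
      (hM t htF.2) ?_
    intro a ha hpa
    have hpD : ∀ c ∈ D, setWeight w' x p t p c = w' p c := fun c hc =>
      setWeight_of_ne (.inl hxp.ne') (.inr (by rintro rfl; exact hx hc))
    rcases hpd a ha hpa with hd | ⟨c, hc, hpc, hne⟩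
    · exact (hd.congr fun c hc => (hpD c hc).symm).mono (Finset.subset_insert _ _)
    · refine ⟨c, Finset.mem_insert_of_mem hc, x, Finset.mem_insert_self _ _, hpc, hxp.symm, ?_⟩
      rwa [hpD c hc, setWeight_right]

/-- To the three values forbidden at `x`, the vertex `p` adds at most one: the weight of one of its
edges to `D`. -/
theorem exists_isGoodOn_insert (h : G.IsGoodOn D w) (hdeg : G.degree x ≤ 4) (hx : x ∉ D)
    (hp : p ∉ D) (hxp : G.Adj x p) : ∃ w', G.IsGoodOn (Insert.insert x D) w' := by
  obtain ⟨w', F, -, hF, hw⟩ := h.exists_insert hdeg hx hp hxp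
  by_cases hpa : ∃ a ∈ D, G.Adj p a
  · obtain ⟨a, ha, hpa⟩ := hpa
    obtain ⟨t, ht, htF⟩ := exists_weight_notMem (F := Insert.insert (w' p a) F)
      ((Finset.card_insert_le _ _).trans (by omega))
    rw [Finset.mem_insert, not_or] at htF
    exact ⟨_, hw t ht htF.2 fun _ _ _ => .inr ⟨a, ha, hpa, Ne.symm htF.1⟩⟩
  · push Not at hpa
    obtain ⟨t, ht, htF⟩ := exists_weight_notMem (F := F) (by omega)
    exact ⟨_, hw t ht htF fun a ha h' => absurd h' (hpa a ha)⟩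

end IsGoodOn

end SimpleGraph
-- The last three vertices of a component, and the order of completion
namespace SimpleGraph

variable {V : Type*}

theorem isGoodOn_empty [Fintype V] {G : SimpleGraph V} [DecidableRel G.Adj] :
    G.IsGoodOn ∅ fun _ _ => 1 := by
  refine ⟨fun _ _ => rfl, fun _ _ => by norm_num, ?_, ?_, ?_⟩ <;> simp

theorem Reachable.exists_adj_dist_lt {G : SimpleGraph V} {r x : V} (h : G.Reachable r x) (hne : x ≠ r) :
    ∃ p, G.Adj x p ∧ G.dist r p < G.dist r x := by
  obtain ⟨W, hW⟩ := h.symm.exists_walk_length_eq_dist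
  cases W with
  | nil => exact absurd rfl hne
  | cons hxp W' =>
    refine ⟨_, hxp, ?_⟩
    rw [dist_comm, dist_comm (u := r), ← hW, Walk.length_cons]
    exact Nat.lt_succ_of_le (dist_le W')

variable [Fintype V] [DecidableEq V] {G : SimpleGraph V} [DecidableRel G.Adj]
  {w : V → V → ℤ} {D : Finset V} {x p : V} {t : ℤ}

/-- At most six values cover `1, …, 6`, so each occurs exactly once. -/
theorem sum_add_sum_eq_of_Icc_subset {α : Type*} [DecidableEq α] {A B : Finset α} {f g : α → ℤ}
    (hA : A.card ≤ 3) (hB : B.card ≤ 3) (h : Finset.Icc (1 : ℤ) 6 ⊆ A.image f ∪ B.image g) :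
    ∑ v ∈ A, f v + ∑ v ∈ B, g v = 21 := by
  have himg : (A.disjSum B).image (Sum.elim f g) = A.image f ∪ B.image g := by
    ext t; simp
  rw [← himg] at h
  have h1 : (Finset.Icc (1 : ℤ) 6).card = 6 := by simp
  have h2 := Finset.card_le_card h
  have h3 : ((A.disjSum B).image (Sum.elim f g)).card ≤ _ := Finset.card_image_le
  have h4 := Finset.card_disjSum A B
  have heq := Finset.eq_of_subset_of_card_le h (by omega)
  have hinj : Set.InjOn (Sum.elim f g) (A.disjSum B : Finset (α ⊕ α)) :=
    Finset.card_image_iff.1 (by omega)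
  have hsum := Finset.sum_image (f := fun t : ℤ => t) hinj
  rw [← heq, Finset.sum_disjSum] at hsum
  simp only [Sum.elim_inl, Sum.elim_inr] at hsum
  rw [← hsum]
  decide

/-- The sum of the weights of `xp` that are forbidden by the sums at the neighbours of `x`. -/
def forbiddenTotal (G : SimpleGraph V) [DecidableRel G.Adj] (D : Finset V) (w : V → V → ℤ)
    (x p : V) : ℤ :=
  ∑ v ∈ G.neighborFinset x ∩ D, (G.weightSum w v - (G.weightSum w x - w x p))

theorem weightSum_setWeight_eq_add (hxp : G.Adj x p) (v : V) :
    G.weightSum (setWeight w x p t) v =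
      G.weightSum (setWeight w x p 0) v + if v = x ∨ v = p then t else 0 := by
  by_cases hx : v = x
  · subst hx; simp [weightSum_setWeight_left hxp]
  by_cases hp : v = p
  · subst hp; simp [weightSum_setWeight_right hxp]
  simp [weightSum_setWeight_of_ne hx hp, hx, hp]

namespace IsGoodOn

theorem card_forbiddenSums_union {M : Finset ℤ} (hdeg : G.degree x ≤ 4) (hp : p ∉ D)
    (hxp : G.Adj x p) (hM : M.card ≤ 1) (hM' : 2 ≤ (G.neighborFinset x ∩ D).card → M = ∅) :
    (G.forbiddenSums D w x p ∪ M).card ≤ 2 ∨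
      (G.neighborFinset x ∩ D).card = 3 ∧ G.degree x = 4 ∧ M = ∅ := by
  have h1 : (G.forbiddenSums D w x p).card ≤ _ := Finset.card_image_le
  have h2 := card_neighborFinset_inter_lt hp hxp
  have h3 := Finset.card_union_le (G.forbiddenSums D w x p) M
  by_cases hc : 2 ≤ (G.neighborFinset x ∩ D).card
  · rw [hM' hc, Finset.card_empty] at h3
    rw [hM' hc]
    by_cases hc' : (G.neighborFinset x ∩ D).card = 3
    · exact .inr ⟨hc', by omega, rfl⟩
    · exact .inl (by omega)
  · exact .inl (by omega)

/-- If one end forbids at most two weights, five do not exhaust the six. Otherwise both ends have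
three completed neighbours, and `htot` rules out full coverage. -/
theorem exists_isGoodOn_insert_insert {q r : V} (h : G.IsGoodOn D w) (hΔ : ∀ v, G.degree v ≤ 4)
    (hq : q ∉ D) (hr : r ∉ D) (hqr : G.Adj q r)
    (hNq : ∀ y, G.Adj q y → y ∈ D ∨ y = r) (hNr : ∀ y, G.Adj r y → y ∈ D ∨ y = q)
    (hne : G.weightSum w q ≠ G.weightSum w r)
    (htot : G.degree r = 4 → G.forbiddenTotal D w q r + G.forbiddenTotal D w r q ≠ 21) :
    ∃ w', G.IsGoodOn (Insert.insert q (Insert.insert r D)) w' := by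
  obtain ⟨M, hM, hM1, hM2⟩ := h.exists_forbidden_diverse hq hr hqr
  obtain ⟨N, hN, hN1, hN2⟩ := h.exists_forbidden_diverse hr hq hqr.symm
  obtain ⟨t, ht, htF⟩ : ∃ t ∈ Set.Icc (1 : ℤ) 6,
      t ∉ (G.forbiddenSums D w q r ∪ M) ∪ (G.forbiddenSums D w r q ∪ N) := by
    have hu := Finset.card_union_le (G.forbiddenSums D w q r ∪ M) (G.forbiddenSums D w r q ∪ N)
    rcases card_forbiddenSums_union (w := w) (hΔ q) hr hqr hM1 hM2 with hq2 | ⟨hq3, -, rfl⟩ <;>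
      rcases card_forbiddenSums_union (w := w) (hΔ r) hq hqr.symm hN1 hN2 with
        hr2 | ⟨hr3, hr4, rfl⟩
    · exact exists_weight_notMem (by omega)
    · have h1 : (G.forbiddenSums D w r q).card ≤ _ := Finset.card_image_le
      rw [Finset.union_empty (G.forbiddenSums D w r q)] at hu ⊢
      exact exists_weight_notMem (by omega)
    · have h1 : (G.forbiddenSums D w q r).card ≤ _ := Finset.card_image_le
      rw [Finset.union_empty (G.forbiddenSums D w q r)] at hu ⊢
      exact exists_weight_notMem (by omega)
    · by_contra! hc
      refine htot hr4 (sum_add_sum_eq_of_Icc_subset hq3.le hr3.le fun t ht => ?_)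
      simpa [forbiddenSums] using hc t (by simpa using ht)
  simp only [Finset.mem_union, not_or] at htF
  refine ⟨_, h.insert_insert hq hr hqr hNq hNr hne ht (ne_of_notMem_forbiddenSums htF.1.1)
    (ne_of_notMem_forbiddenSums htF.2.1) (hM t htF.1.2) ?_⟩
  rw [setWeight_swap]
  exact hN t htF.2.2

/-- Raising `t` by one raises the sum at `z` and the sum at `r`. The term of `z` gains one at `r`,
and at `q` if `qz` is an edge; all three terms at `r` lose one. The total is thus affine in `t` with
slope `-2` or `-1`. -/
theorem exists_forbiddenTotal_ne {z q r : V} (hzr : G.Adj z r) (hqr : G.Adj q r) (hzq : z ≠ q)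
    (hr : r ∉ D) (hcard : (G.neighborFinset r ∩ Insert.insert z D).card = 3) :
    ∃ e : ℤ, ∀ t ≠ e, G.forbiddenTotal (Insert.insert z D) (setWeight w z r t) q r +
      G.forbiddenTotal (Insert.insert z D) (setWeight w z r t) r q ≠ 21 := by
  have hrD : r ∉ Insert.insert z D := by simp [hzr.ne', hr]
  have hq : ∀ t, G.forbiddenTotal (Insert.insert z D) (setWeight w z r t) q r =
      G.forbiddenTotal (Insert.insert z D) (setWeight w z r 0) q r +
        if G.Adj q z then t else 0 := by
    intro t
    have key : ∀ v ∈ G.neighborFinset q ∩ Insert.insert z D,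
        G.weightSum (setWeight w z r t) v -
          (G.weightSum (setWeight w z r t) q - setWeight w z r t q r) =
        G.weightSum (setWeight w z r 0) v -
          (G.weightSum (setWeight w z r 0) q - setWeight w z r 0 q r) + if v = z then t else 0 := by
      intro v hv
      have hvr : v ≠ r := by rintro rfl; exact hrD (Finset.mem_inter.1 hv).2
      rw [weightSum_setWeight_eq_add hzr v, weightSum_setWeight_eq_add hzr q,
        setWeight_of_ne (.inl hzq.symm) (.inl hqr.ne),
        setWeight_of_ne (.inl hzq.symm) (.inl hqr.ne)]
      simp only [hvr, hqr.ne, hzq.symm, or_false, if_false]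
      ring
    rw [forbiddenTotal, Finset.sum_congr rfl key, Finset.sum_add_distrib, Finset.sum_ite_eq',
      forbiddenTotal]
    simp
  have hr' : ∀ t, G.forbiddenTotal (Insert.insert z D) (setWeight w z r t) r q =
      G.forbiddenTotal (Insert.insert z D) (setWeight w z r 0) r q - 2 * t := by
    intro t
    have key : ∀ v ∈ G.neighborFinset r ∩ Insert.insert z D,
        G.weightSum (setWeight w z r t) v -
          (G.weightSum (setWeight w z r t) r - setWeight w z r t r q) =
        G.weightSum (setWeight w z r 0) v -
          (G.weightSum (setWeight w z r 0) r - setWeight w z r 0 r q) +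
          ((if v = z then t else 0) + -t) := by
      intro v hv
      have hvr : v ≠ r := by rintro rfl; exact hrD (Finset.mem_inter.1 hv).2
      rw [weightSum_setWeight_eq_add hzr v, weightSum_setWeight_eq_add hzr r,
        setWeight_of_ne (.inl hzr.ne') (.inr hzq.symm),
        setWeight_of_ne (.inl hzr.ne') (.inr hzq.symm)]
      simp only [hvr, or_false, or_true, if_true]
      ring
    rw [forbiddenTotal, Finset.sum_congr rfl key, Finset.sum_add_distrib, Finset.sum_add_distrib,
      Finset.sum_ite_eq', Finset.sum_const, hcard, forbiddenTotal]
    simp only [Finset.mem_inter, mem_neighborFinset, hzr.symm, Finset.mem_insert_self, and_self,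
      if_true, nsmul_eq_mul]
    push_cast
    ring
  -- The root of the affine equation; when the division is inexact there is no integer root and `e`
  -- is harmless.
  refine ⟨if G.Adj q z then
    G.forbiddenTotal (Insert.insert z D) (setWeight w z r 0) q r +
      G.forbiddenTotal (Insert.insert z D) (setWeight w z r 0) r q - 21 else
    (G.forbiddenTotal (Insert.insert z D) (setWeight w z r 0) q r +
      G.forbiddenTotal (Insert.insert z D) (setWeight w z r 0) r q - 21) / 2, fun t ht he => ?_⟩
  rw [hq, hr'] at he
  split_ifs at he ht <;> omega

/-- Completing the last three vertices of a component. -/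
theorem exists_isGoodOn_insert_insert_insert {z q r : V} (h : G.IsGoodOn D w)
    (hΔ : ∀ v, G.degree v ≤ 4) (hz : z ∉ D) (hq : q ∉ D) (hr : r ∉ D)
    (hzr : G.Adj z r) (hqr : G.Adj q r) (hzq : z ≠ q)
    (hNq : ∀ y, G.Adj q y → y ∈ D ∨ y = z ∨ y = r)
    (hNr : ∀ y, G.Adj r y → y ∈ D ∨ y = z ∨ y = q) :
    ∃ w', G.IsGoodOn (Insert.insert q (Insert.insert r (Insert.insert z D))) w' := by
  obtain ⟨w₀, F, h₀, hF, hins⟩ := h.exists_insert (hΔ z) hz hr hzr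
  -- Of the last two conditions only one ever costs a value: in degree 4, `r` already has two edges
  -- to `D`, hence two weights; in other degrees the total is irrelevant.
  suffices ∃ t ∈ Set.Icc (1 : ℤ) 6, t ∉ F ∧ t ≠ G.weightSum w₀ q - G.weightSum w₀ r + w₀ r z ∧
      (∀ a ∈ D, G.Adj r a → G.Diverse D w₀ r ∨ ∃ c ∈ D, G.Adj r c ∧ w₀ r c ≠ t) ∧
      (G.degree r = 4 → G.forbiddenTotal (Insert.insert z D) (setWeight w₀ z r t) q r +
        G.forbiddenTotal (Insert.insert z D) (setWeight w₀ z r t) r q ≠ 21) by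
    obtain ⟨t, ht, htF, hte, hdiv, htot⟩ := this
    refine (hins t ht htF hdiv).exists_isGoodOn_insert_insert hΔ (by simp [hzq.symm, hq])
      (by simp [hzr.ne', hr]) hqr ?_ ?_ ?_ htot
    · intro y hy; have := hNq y hy; simp only [Finset.mem_insert]; tauto
    · intro y hy; have := hNr y hy; simp only [Finset.mem_insert]; tauto
    · rw [weightSum_setWeight_of_ne hzq.symm hqr.ne, weightSum_setWeight_right hzr]
      intro he; exact hte (by linarith)
  have hcard : (G.neighborFinset r ∩ Insert.insert z D).card + 1 = G.degree r := by
    rw [← card_neighborFinset_eq_degree,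
      ← Finset.card_erase_add_one (show q ∈ G.neighborFinset r by simpa using hqr.symm)]
    congr 2
    ext y
    simp only [Finset.mem_inter, mem_neighborFinset, Finset.mem_insert, Finset.mem_erase]
    constructor
    · rintro ⟨h1, h2⟩
      refine ⟨?_, h1⟩
      rintro rfl
      exact h2.elim (fun h => hzq h.symm) hq
    · rintro ⟨h1, h2⟩
      have := hNr y h2
      tauto
  have hcard' : (G.neighborFinset r ∩ Insert.insert z D).card ≤
      (G.neighborFinset r ∩ D).card + 1 := by
    rw [Finset.inter_insert_of_mem (by simpa using hzr.symm)]
    exact Finset.card_insert_le _ _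
  by_cases hr4 : G.degree r = 4
  · obtain ⟨e, he⟩ := exists_forbiddenTotal_ne (w := w₀) hzr hqr hzq hr (by omega)
    obtain ⟨t, ht, htF⟩ := exists_weight_notMem (F := Insert.insert e
      (Insert.insert (G.weightSum w₀ q - G.weightSum w₀ r + w₀ r z) F))
      ((Finset.card_insert_le _ _).trans (Nat.succ_le_succ
        ((Finset.card_insert_le _ _).trans (Nat.succ_le_succ hF))))
    simp only [Finset.mem_insert, not_or] at htF
    refine ⟨t, ht, htF.2.2, htF.2.1, fun _ _ _ => .inl ?_, fun _ => he t htF.1⟩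
    obtain ⟨a, ha, b, hb, hab⟩ :=
      Finset.one_lt_card.1 (show 1 < (G.neighborFinset r ∩ D).card by omega)
    simp only [Finset.mem_inter, mem_neighborFinset] at ha hb
    exact h₀.diverse_out r hr a ha.2 b hb.2 ha.1 hb.1 hab
  · by_cases hra : ∃ a ∈ D, G.Adj r a
    · obtain ⟨a, ha, hra⟩ := hra
      obtain ⟨t, ht, htF⟩ := exists_weight_notMem (F := Insert.insert (w₀ r a)
        (Insert.insert (G.weightSum w₀ q - G.weightSum w₀ r + w₀ r z) F))
        ((Finset.card_insert_le _ _).trans (Nat.succ_le_succ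
          ((Finset.card_insert_le _ _).trans (Nat.succ_le_succ hF))))
      simp only [Finset.mem_insert, not_or] at htF
      exact ⟨t, ht, htF.2.2, htF.2.1, fun _ _ _ => .inr ⟨a, ha, hra, Ne.symm htF.1⟩,
        fun h4 => absurd h4 hr4⟩
    · push Not at hra
      obtain ⟨t, ht, htF⟩ := exists_weight_notMem (F :=
        Insert.insert (G.weightSum w₀ q - G.weightSum w₀ r + w₀ r z) F)
        ((Finset.card_insert_le _ _).trans (by omega))
      simp only [Finset.mem_insert, not_or] at htF
      exact ⟨t, ht, htF.2, htF.1, fun a ha h' => absurd h' (hra a ha), fun h4 => absurd h4 hr4⟩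

end IsGoodOn

theorem exists_isGoodOn_reachable (hΔ : ∀ v, G.degree v ≤ 4) {r : V} (hr : 2 ≤ G.degree r) :
    ∃ D w, G.IsGoodOn D w ∧ ∀ v, G.Reachable r v → v ∈ D := by
  classical
  obtain ⟨z, hz, q, hq, hzq⟩ := Finset.one_lt_card.1 (show 1 < (G.neighborFinset r).card from hr)
  rw [mem_neighborFinset] at hz hq
  -- Closure under larger distance encodes the processing order.
  let S : Finset (Finset V) := Finset.univ.filter fun D => (∃ w, G.IsGoodOn D w) ∧
    (z ∉ D ∧ q ∉ D ∧ r ∉ D) ∧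
      ∀ x ∈ D, ∀ y, y ≠ z → y ≠ q → G.Reachable r y → G.dist r x < G.dist r y → y ∈ D
  obtain ⟨D, hDS, hmax⟩ := S.exists_max_image Finset.card
    ⟨∅, by simpa [S] using ⟨_, isGoodOn_empty⟩⟩
  obtain ⟨⟨w, hw⟩, ⟨hzD, hqD, hrD⟩, hup⟩ := (Finset.mem_filter.1 hDS).2
  have hall : ∀ v, G.Reachable r v → v ∈ D ∨ v = z ∨ v = q ∨ v = r := by
    by_contra! hc
    obtain ⟨v, hv, hvD, hvz, hvq, hvr⟩ := hc
    obtain ⟨x, hxT, hxmax⟩ := (Finset.univ.filter fun v =>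
      G.Reachable r v ∧ v ∉ D ∧ v ≠ z ∧ v ≠ q ∧ v ≠ r).exists_max_image (G.dist r)
      ⟨v, by simp [*]⟩
    obtain ⟨hrx, hxD, hxz, hxq, hxr⟩ := (Finset.mem_filter.1 hxT).2
    obtain ⟨p, hxp, hdist⟩ := hrx.exists_adj_dist_lt hxr
    -- If `p` were completed, closure would force the farther vertex `x` into `D`.
    have hpD : p ∉ D := fun hp => hxD (hup p hp x hxz hxq hrx hdist)
    have hmem : insert x D ∈ S := by
      refine Finset.mem_filter.2 ⟨Finset.mem_univ _,
        hw.exists_isGoodOn_insert (hΔ x) hxD hpD hxp, ?_, ?_⟩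
      · simp [hzD, hqD, hrD, hxz.symm, hxq.symm, hxr.symm]
      · intro a ha y hyz hyq hry hlt
        rw [Finset.mem_insert] at ha ⊢
        rcases ha with rfl | ha
        · by_contra! hc
          have hyr : y ≠ r := by rintro rfl; simp at hlt
          exact absurd (hxmax y (by simp [*])) (by omega)
        · exact .inr (hup a ha y hyz hyq hry hlt)
    have := hmax _ hmem
    rw [Finset.card_insert_of_notMem hxD] at this
    omega
  obtain ⟨w', hw'⟩ := hw.exists_isGoodOn_insert_insert_insert hΔ hzD hqD hrD hz.symm hq.symm hzq
    (fun y hy => by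
      rcases hall y (hq.reachable.trans hy.reachable) with h | h | h | h
      exacts [.inl h, .inr (.inl h), absurd h hy.ne', .inr (.inr h)])
    (fun y hy => by
      rcases hall y hy.reachable with h | h | h | h
      exacts [.inl h, .inr (.inl h), .inr (.inr h), absurd h hy.ne'])
  refine ⟨_, w', hw', fun v hv => ?_⟩
  have := hall v hv
  simp only [Finset.mem_insert]
  tauto

end SimpleGraph
-- Niceness, gluing of components, and the relaxed index
namespace SimpleGraph

variable {V : Type*}

/-- In a nice graph every edge has an end of degree at least two. -/
theorem IsNice.two_le_degree_or [Fintype V] {G : SimpleGraph V} [DecidableRel G.Adj]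
    (hG : G.IsNice) {u v : V} (huv : G.Adj u v) : 2 ≤ G.degree u ∨ 2 ≤ G.degree v := by
  classical
  by_contra! hc
  have hu : ∀ y, G.Adj u y → y = v := fun y hy => by
    by_contra hne
    have : 1 < (G.neighborFinset u).card :=
      Finset.one_lt_card.2 ⟨y, by simpa using hy, v, by simpa using huv, hne⟩
    have := G.card_neighborFinset_eq_degree u
    omega
  have hv : ∀ y, G.Adj v y → y = u := fun y hy => by
    by_contra hne
    have : 1 < (G.neighborFinset v).card :=
      Finset.one_lt_card.2 ⟨y, by simpa using hy, u, by simpa using huv.symm, hne⟩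
    have := G.card_neighborFinset_eq_degree v
    omega
  have hwalk : ∀ {a b : V}, G.Walk a b → a = u ∨ a = v → b = u ∨ b = v := by
    intro a b W
    induction W with
    | nil => exact id
    | cons h _ ih =>
      rintro (rfl | rfl)
      exacts [ih (.inr (hu _ h)), ih (.inl (hv _ h))]
  have hmem : ∀ y : (G.connectedComponentMk u), y.1 = u ∨ y.1 = v := fun y =>
    hwalk (ConnectedComponent.exact y.2).symm.some (.inl rfl)
  have hvu : v ∈ G.connectedComponentMk u := ConnectedComponent.sound huv.symm.reachable
  let e : (G.connectedComponentMk u) ≃ Fin 2 :=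
    { toFun := fun y => if y.1 = u then 0 else 1
      invFun := fun i => if i = 0 then ⟨u, rfl⟩ else ⟨v, hvu⟩
      left_inv := fun y => by
        rcases hmem y with h | h
        · simp [← h]
        · have : y.1 ≠ u := h ▸ huv.ne'
          simp [this, ← h]
      right_inv := fun i => by
        fin_cases i
        · simp
        · simp [huv.ne'] }
  refine (hG (G.connectedComponentMk u)).false ⟨e, ?_⟩
  intro a b
  rw [completeGraph_eq_top, top_adj, e.injective.ne_iff]
  change a ≠ b ↔ G.Adj a.1 b.1
  rcases hmem a with ha | ha <;> rcases hmem b with hb | hb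
  all_goals simp [Subtype.ext_iff, ha, hb, huv, huv.symm, huv.ne, huv.ne']

theorem exists_weight_component [Fintype V] {G : SimpleGraph V} [DecidableRel G.Adj]
    (hG : G.IsNice) (hΔ : ∀ v, G.degree v ≤ 4) (c : G.ConnectedComponent) :
    ∃ w : V → V → ℤ, (∀ a b, w a b = w b a) ∧ (∀ a b, w a b ∈ Set.Icc (1 : ℤ) 6) ∧
      (∀ x y, G.connectedComponentMk x = c → G.Adj x y → G.weightSum w x ≠ G.weightSum w y) ∧
      ∀ x, G.connectedComponentMk x = c → 2 ≤ G.degree x →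
        ∃ a b, G.Adj x a ∧ G.Adj x b ∧ w x a ≠ w x b := by
  classical
  by_cases hr : ∃ r, G.connectedComponentMk r = c ∧ 2 ≤ G.degree r
  · obtain ⟨r, rfl, hr⟩ := hr
    obtain ⟨D, w, hw, hD⟩ := exists_isGoodOn_reachable hΔ hr
    have hD' : ∀ x, G.connectedComponentMk x = G.connectedComponentMk r → x ∈ D := fun x hx =>
      hD x (ConnectedComponent.exact hx).symm
    refine ⟨w, hw.symm, hw.mem_Icc, fun x y hx hxy => hw.sum_ne x (hD' x hx) y (hD' y ?_) hxy,
      fun x hx hdeg => ?_⟩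
    · rw [← hx]; exact ConnectedComponent.sound hxy.symm.reachable
    · obtain ⟨a, -, b, -, h⟩ := hw.diverse x (hD' x hx) hdeg
      exact ⟨a, b, h⟩
  -- By niceness such a component has no edge.
  · push Not at hr
    refine ⟨fun _ _ => 1, fun _ _ => rfl, fun _ _ => by norm_num, fun x y hx hxy => ?_,
      fun x hx hdeg => absurd (hr x hx) (by omega)⟩
    have hy : G.connectedComponentMk y = c := by
      rw [← hx]; exact ConnectedComponent.sound hxy.symm.reachable
    have := hr x hx
    have := hr y hy
    have := hG.two_le_degree_or hxy
    omega

namespace EdgeWeighting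

theorem exists_nsd_hasTwoWeightsAt [Fintype V] {G : SimpleGraph V} [DecidableRel G.Adj]
    (hG : G.IsNice) (hΔ : ∀ v, G.degree v ≤ 4) :
    ∃ ω : G.EdgeWeighting 6, ω.NeighbourSumDistinguishing ∧
      ∀ v : V, 2 ≤ G.degree v → ω.HasTwoWeightsAt v := by
  classical
  choose W hsymm hIcc hsum hdiv using exists_weight_component hG hΔ
  have hcomp : ∀ a b, G.Adj a b → G.connectedComponentMk a = G.connectedComponentMk b :=
    fun a b h => ConnectedComponent.sound h.reachable
  let f : Sym2 V → ℤ := Sym2.lift ⟨fun a b => if G.Adj a b then W (G.connectedComponentMk a) a b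
    else 1, fun a b => by
      beta_reduce
      by_cases h : G.Adj a b
      · rw [if_pos h, if_pos h.symm, hcomp a b h, hsymm]
      · rw [if_neg h, if_neg fun h' => h h'.symm]⟩
  have hf : ∀ a b, G.Adj a b → f s(a, b) = W (G.connectedComponentMk a) a b := fun a b h => by
    simp [f, h]
  have hf6 : ∀ e, f e ∈ Set.Icc (1 : ℤ) 6 := fun e => by
    induction e with
    | _ a b =>
      simp only [f, Sym2.lift_mk]
      split_ifs
      exacts [hIcc _ a b, by norm_num]
  let ω : G.EdgeWeighting 6 := fun e => ⟨(f e).toNat, by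
    have := hf6 e; simp only [Set.mem_Icc] at this ⊢; omega⟩
  have hω : ∀ v u (h : G.Adj v u), (ω.weight h : ℤ) = W (G.connectedComponentMk v) v u := by
    intro v u h
    rw [← hf v u h]
    exact Int.toNat_of_nonneg (zero_le_one.trans (hf6 s(v, u)).1)
  have hsumω : ∀ v, (ω.vertexSum v : ℤ) = G.weightSum (W (G.connectedComponentMk v)) v := by
    intro v
    rw [vertexSum, weightSum, Nat.cast_sum, Finset.sum_subtype (p := fun u => u ∈ G.neighborSet v)
      (G.neighborFinset v) (by simp)]
    exact Finset.sum_congr rfl fun u _ => hω v u u.2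
  refine ⟨ω, fun v w hvw he => ?_, fun v hv => ?_⟩
  · apply hsum _ v w rfl hvw
    have := hsumω w
    rw [← hcomp v w hvw] at this
    rw [← hsumω v, ← this, he]
  · obtain ⟨a, b, ha, hb, hne⟩ := hdiv _ v rfl hv
    refine ⟨⟨s(v, a), ha⟩, ⟨s(v, b), hb⟩, by simp, by simp, fun he => hne ?_⟩
    rw [← hω v a ha, ← hω v b hb]
    exact congrArg (fun z : Set.Icc 1 6 => ((z : ℕ) : ℤ)) he

theorem isRelaxed_of_hasTwoWeightsAt [Fintype V] {G : SimpleGraph V} [DecidableRel G.Adj]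
    (hG : G.IsNice) {k : ℕ} {ω : G.EdgeWeighting k}
    (hω : ∀ v : V, 2 ≤ G.degree v → ω.HasTwoWeightsAt v) : ω.IsRelaxed (G.maxDegree - 1) := by
  classical
  intro S hS v
  have hinj : Set.InjOn (fun e : G.edgeSet => (e : Sym2 V)) {e ∈ S | v ∈ (e : Sym2 V)} :=
    Subtype.val_injective.injOn
  rw [← hinj.encard_image]
  have hsub : (fun e : G.edgeSet => (e : Sym2 V)) '' {e ∈ S | v ∈ (e : Sym2 V)} ⊆
      (G.incidenceFinset v : Set (Sym2 V)) := by
    rintro _ ⟨e, ⟨-, hve⟩, rfl⟩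
    simpa using ⟨e.2, hve⟩
  have hdeg := G.degree_le_maxDegree v
  by_cases h2 : 2 ≤ G.degree v
  · obtain ⟨e, f, he, hf, hne⟩ := hω v h2
    -- A monochromatic set misses one of two differently weighted edges at `v`.
    obtain ⟨g, hg, hgS⟩ : ∃ g : G.edgeSet, v ∈ (g : Sym2 V) ∧ g ∉ S := by
      by_contra! hc
      exact hne (hS e (hc e he) f (hc f hf))
    have hsub' : (fun e : G.edgeSet => (e : Sym2 V)) '' {e ∈ S | v ∈ (e : Sym2 V)} ⊆
        ((G.incidenceFinset v).erase g : Finset (Sym2 V)) := by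
      rintro _ ⟨e, he', rfl⟩
      rw [Finset.coe_erase]
      refine ⟨hsub ⟨e, he', rfl⟩, fun h => hgS ?_⟩
      rw [← Subtype.ext (Set.mem_singleton_iff.1 h)]
      exact he'.1
    refine (Set.encard_le_encard hsub').trans ?_
    rw [Set.encard_coe_eq_coe_finsetCard, Finset.card_erase_of_mem (by
      rw [mem_incidenceFinset]; exact ⟨g.2, hg⟩), card_incidenceFinset_eq_degree]
    exact_mod_cast Nat.sub_le_sub_right hdeg 1
  · refine (Set.encard_le_encard hsub).trans ?_
    rw [Set.encard_coe_eq_coe_finsetCard, card_incidenceFinset_eq_degree]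
    norm_cast
    -- If `v` has degree 1, its neighbour has degree at least 2 by niceness, so `Δ - 1 ≥ 1`.
    rcases Nat.eq_zero_or_pos (G.degree v) with h0 | h0
    · omega
    · obtain ⟨u, hu⟩ := (G.degree_pos_iff_exists_adj v).1 h0
      have := hG.two_le_degree_or hu
      have := G.degree_le_maxDegree u
      omega

end EdgeWeighting

end SimpleGraph

theorem mainTheorem4 {V : Type*} [Fintype V] (G : SimpleGraph V) [DecidableRel G.Adj]
    (hnice : G.IsNice) (hΔ : G.maxDegree ≤ 4) :
    (∃ ω : G.EdgeWeighting 6, ω.NeighbourSumDistinguishing ∧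
      ∀ v : V, 2 ≤ G.degree v → ω.HasTwoWeightsAt v) ∧
    G.nsdRelaxedIndex (G.maxDegree - 1) ≤ 6 := by
  obtain ⟨ω, hω, h2⟩ := SimpleGraph.EdgeWeighting.exists_nsd_hasTwoWeightsAt hnice
    fun v => (G.degree_le_maxDegree v).trans hΔ
  refine ⟨⟨ω, hω, h2⟩, ?_⟩
  exact iInf₂_le (f := fun (k : ℕ) _ => (k : ℕ∞)) 6
    ⟨by norm_num, ω, hω, SimpleGraph.EdgeWeighting.isRelaxed_of_hasTwoWeightsAt hnice h2⟩
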